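/- Let $\mathbf{C}$ be a symmetric monoidal closed category, with symmetry $\gamma$, which is total, i.e. $\mathbf{C}$ is locally small and its Yoneda embedding $\mathbf{C}\to\mathbf{Set}^{\mathbf{C}^{\mathrm{op}}}$ has a left adjoint. Then every strong monad $(\mathcal{T},\eta,\mu,\tau)$ on $\mathbf{C}$, with left strength $\tau_{X,Y}\colon X\otimes\mathcal{T}Y\to\mathcal{T}(X\otimes Y)$, is centralisable. Here, writing $\tau'_{X,Y}=\mathcal{T}(\gamma_{Y,X})\circ\tau_{Y,X}\circ\gamma_{\mathcal{T}X,Y}\colon \mathcal{T}X\otimes Y\to\mathcal{T}(X\otimes Y)$ for the right strength, a central cone of $\mathcal{T}$ at an object $X$ is a pair $(Z,\iota)$ of an object $Z$ and a morphism $\iota\colon Z\to\mathcal{T}X$ such that for every object $Y$ $$\mu_{X\otimes Y}\circ\mathcal{T}\tau_{X,Y}\circ\tau'_{X,\mathcal{T}Y}\circ(\iota\otimes\mathcal{T}Y)=\mu_{X\otimes Y}\circ\mathcal{T}\tau'_{X,Y}\circ\tau_{\mathcal{T}X,Y}\circ(\iota\otimes\mathcal{T}Y).$$ A morphism of central cones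 $(Z',\iota')\to(Z,\iota)$ is a morphism $\varphi\colon Z'\to Z$ with $\iota\circ\varphi=\iota'$. The monad $\mathcal{T}$ is centralisable if for every object $X$ the category of central cones of $\mathcal{T}$ at $X$ has a terminal object. -/

import Mathlib

open CategoryTheory MonoidalCategory

universe v u

/-- A category with hom-sets in `Type v` is total if its Yoneda embedding into the category of
presheaves of `v`-small sets has a left adjoint. -/
class IsTotalCategory (C : Type u) [Category.{v} C] : Prop where
  yoneda_isRightAdjoint : (yoneda : C ⥤ Cᵒᵖ ⥤ Type v).IsRightAdjoint

/-- A (left) strong monad on a monoidal category: a monad together with a natural transformation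
`τ X Y : X ⊗ T Y ⟶ T (X ⊗ Y)` compatible with the unitor, the associator, the unit and the
multiplication. -/
structure StrongMonad (C : Type u) [Category.{v} C] [MonoidalCategory.{v} C] extends Monad C where
  /-- the left strength -/
  τ : ∀ X Y : C, X ⊗ toFunctor.obj Y ⟶ toFunctor.obj (X ⊗ Y)
  τ_naturality : ∀ {X X' Y Y' : C} (f : X ⟶ X') (g : Y ⟶ Y'),
    (f ⊗ₘ toFunctor.map g) ≫ τ X' Y' = τ X Y ≫ toFunctor.map (f ⊗ₘ g)
  τ_leftUnitor : ∀ X : C,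
    τ (𝟙_ C) X ≫ toFunctor.map (λ_ X).hom = (λ_ (toFunctor.obj X)).hom
  τ_associator : ∀ X Y Z : C,
    τ (X ⊗ Y) Z ≫ toFunctor.map (α_ X Y Z).hom =
      (α_ X Y (toFunctor.obj Z)).hom ≫ X ◁ τ Y Z ≫ τ X (Y ⊗ Z)
  τ_η : ∀ X Y : C, X ◁ η.app Y ≫ τ X Y = η.app (X ⊗ Y)
  τ_μ : ∀ X Y : C,
    X ◁ μ.app Y ≫ τ X Y =
      τ X (toFunctor.obj Y) ≫ toFunctor.map (τ X Y) ≫ μ.app (X ⊗ Y)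

namespace StrongMonad

/-- The right strength `T X ⊗ Y ⟶ T (X ⊗ Y)` obtained from the left strength by symmetry. -/
def rightStrength {C : Type u} [Category.{v} C] [MonoidalCategory.{v} C] [SymmetricCategory C]
    (T : StrongMonad C) (X Y : C) : T.obj X ⊗ Y ⟶ T.obj (X ⊗ Y) :=
  (β_ (T.obj X) Y).hom ≫ T.τ Y X ≫ T.map (β_ Y X).hom

/-- A central cone of `T` at `X`: an object `Z` with a morphism `ι : Z ⟶ T X` such that, for every
`Y`, the two composites `Z ⊗ T Y ⟶ T X ⊗ T Y ⟶ T (X ⊗ Y)` (first `T X` then `T Y`, and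
first `T Y` then `T X`) agree. -/
structure CentralCone {C : Type u} [Category.{v} C] [MonoidalCategory.{v} C] [SymmetricCategory C]
    (T : StrongMonad C) (X : C) where
  /-- the apex -/
  Z : C
  /-- the structure morphism -/
  ι : Z ⟶ T.obj X
  central : ∀ Y : C,
    ι ▷ T.obj Y ≫ T.rightStrength X (T.obj Y) ≫ T.map (T.τ X Y) ≫ T.μ.app (X ⊗ Y) =
      ι ▷ T.obj Y ≫ T.τ (T.obj X) Y ≫ T.map (T.rightStrength X Y) ≫ T.μ.app (X ⊗ Y)

/-- A morphism of central cones is a morphism between the apexes commuting with the structure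
morphisms. -/
@[ext]
structure CentralCone.Hom {C : Type u} [Category.{v} C] [MonoidalCategory.{v} C]
    [SymmetricCategory C] {T : StrongMonad C} {X : C} (c' c : CentralCone T X) where
  /-- the underlying morphism of apexes -/
  φ : c'.Z ⟶ c.Z
  w : φ ≫ c.ι = c'.ι

/-- The category of central cones of `T` at `X`. -/
instance CentralCone.category {C : Type u} [Category.{v} C] [MonoidalCategory.{v} C]
    [SymmetricCategory C] (T : StrongMonad C) (X : C) : Category.{v} (CentralCone T X) where
  Hom c' c := CentralCone.Hom c' c
  id c := ⟨𝟙 c.Z, Category.id_comp _⟩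
  comp f g := ⟨f.φ ≫ g.φ, by rw [Category.assoc, g.w, f.w]⟩
  id_comp f := CentralCone.Hom.ext (Category.id_comp f.φ)
  comp_id f := CentralCone.Hom.ext (Category.comp_id f.φ)
  assoc f g h := CentralCone.Hom.ext (Category.assoc f.φ g.φ h.φ)

/-- A strong monad is centralisable if, for every object `X`, there is a terminal central cone
at `X`. -/
def IsCentralisable {C : Type u} [Category.{v} C] [MonoidalCategory.{v} C] [SymmetricCategory C]
    (T : StrongMonad C) : Prop :=
  ∀ X : C, ∃ c : CentralCone T X, Nonempty (Limits.IsTerminal c)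

end StrongMonad

/-! By closedness, centrality of `ι` says that `ι` equalizes a family of parallel pairs out of `T
X`, one for each object `Y`; a terminal central cone is thus a joint equalizer. The family may be
large, but the maps equalizing it form a sieve, a presheaf of `v`-small sets whatever the index.
Totality reflects this sieve to an object `E`, which turns out to represent it. -/

/-- In a total category every family of parallel pairs out of `A`, indexed by a type of arbitrary
size, has a joint equalizer. -/
theorem IsTotalCategory.exists_jointEqualizer {C : Type u} [Category.{v} C] [IsTotalCategory C]
    {A : C} {I : Type*} {W : I → C} (f g : ∀ i, A ⟶ W i) :
    ∃ (E : C) (ι : E ⟶ A), (∀ i, ι ≫ f i = ι ≫ g i) ∧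
      ∀ (Z : C) (k : Z ⟶ A), (∀ i, k ≫ f i = k ≫ g i) → ∃! φ : Z ⟶ E, φ ≫ ι = k := by
  have := IsTotalCategory.yoneda_isRightAdjoint (C := C)
  let adj := Adjunction.ofIsRightAdjoint (yoneda : C ⥤ Cᵒᵖ ⥤ Type v)
  let S : Sieve A :=
    { arrows := fun Z k => ∀ i, k ≫ f i = k ≫ g i
      downward_closed := fun {Y Z k} hk h i => by
        rw [Category.assoc, Category.assoc, hk i] }
  let E : C := (Functor.leftAdjoint yoneda).obj S.functor
  let e : S.functor ⟶ yoneda.obj E := adj.unit.app S.functor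
  let ι : E ⟶ A := (adj.homEquiv S.functor A).symm S.functorInclusion
  -- Maps out of the reflection `E` are determined by their restriction along the unit `e`.
  have hext {B : C} {a b : E ⟶ B} (h : e ≫ yoneda.map a = e ≫ yoneda.map b) : a = b := by
    apply (adj.homEquiv S.functor B).injective
    rw [adj.homEquiv_unit, adj.homEquiv_unit]
    exact h
  have hι : e ≫ yoneda.map ι = S.functorInclusion :=
    (adj.homEquiv_unit _ _ _).symm.trans ((adj.homEquiv S.functor A).apply_symm_apply _)
  let lift {Z : C} (k : Z ⟶ A) (hk : S k) : Z ⟶ E := e.app (.op Z) ⟨k, hk⟩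
  have lift_comp {Z : C} (k : Z ⟶ A) (hk : S k) : lift k hk ≫ ι = k :=
    congr($(hι).app (.op Z) ⟨k, hk⟩)
  have comp_lift {Y Z : C} (h : Y ⟶ Z) {k : Z ⟶ A} (hk : S k) {k' : Y ⟶ A} (hk' : S k')
      (w : h ≫ k = k') : h ≫ lift k hk = lift k' hk' := by
    subst w
    exact (NatTrans.naturality_apply e h.op ⟨k, hk⟩).symm
  have hS : S ι := fun i => by
    apply hext
    rw [yoneda.map_comp, yoneda.map_comp, reassoc_of% hι, reassoc_of% hι]
    ext Z k
    exact k.2 i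
  -- This is what gives uniqueness: any `φ` equals `φ ≫ lift ι hS`, which by naturality of `e`
  -- depends only on `φ ≫ ι`.
  have lift_ι : lift ι hS = 𝟙 E := by
    apply hext
    ext Z k
    change lift k.1 k.2 ≫ lift ι hS = lift k.1 k.2 ≫ 𝟙 E
    rw [Category.comp_id, comp_lift _ hS k.2 (lift_comp k.1 k.2)]
  refine ⟨E, ι, hS, fun Z k hk => ⟨lift k hk, lift_comp k hk, fun φ hφ => ?_⟩⟩
  rw [← comp_lift φ hS hk hφ, lift_ι, Category.comp_id]

/-- In a braided closed category, equality of whiskered composites out of `A ⊗ B` can be tested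
after currying away `B`. -/
theorem whiskerRight_comp_eq_iff_comp_curry_eq {C : Type u} [Category.{v} C]
    [MonoidalCategory.{v} C] [BraidedCategory C] [MonoidalClosed C] {Z A B W : C} (k : Z ⟶ A)
    (f g : A ⊗ B ⟶ W) :
    k ▷ B ≫ f = k ▷ B ≫ g ↔
      k ≫ MonoidalClosed.curry ((β_ B A).hom ≫ f) =
        k ≫ MonoidalClosed.curry ((β_ B A).hom ≫ g) := by
  -- `curry` transposes the left tensor factor, so `B` is first braided to the left.
  rw [← MonoidalClosed.curry_natural_left, ← MonoidalClosed.curry_natural_left,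
    MonoidalClosed.curry_injective.eq_iff, BraidedCategory.braiding_naturality_right_assoc,
    BraidedCategory.braiding_naturality_right_assoc, cancel_epi (β_ B Z).hom]

theorem mainTheorem7 (C : Type u) [Category.{v} C] [MonoidalCategory.{v} C] [SymmetricCategory C]
    [MonoidalClosed C] [IsTotalCategory C] (T : StrongMonad C) : T.IsCentralisable := by
  intro X
  obtain ⟨E, ι, hι, huniv⟩ := IsTotalCategory.exists_jointEqualizer
    (fun Y : C => MonoidalClosed.curry ((β_ (T.obj Y) (T.obj X)).hom ≫
      T.rightStrength X (T.obj Y) ≫ T.map (T.τ X Y) ≫ T.μ.app (X ⊗ Y)))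
    (fun Y : C => MonoidalClosed.curry ((β_ (T.obj Y) (T.obj X)).hom ≫
      T.τ (T.obj X) Y ≫ T.map (T.rightStrength X Y) ≫ T.μ.app (X ⊗ Y)))
  choose φ hφ hφ_unique using fun c : T.CentralCone X =>
    huniv c.Z c.ι fun Y => (whiskerRight_comp_eq_iff_comp_curry_eq _ _ _).1 (c.central Y)
  let c₀ : T.CentralCone X :=
    ⟨E, ι, fun Y => (whiskerRight_comp_eq_iff_comp_curry_eq _ _ _).2 (hι Y)⟩
  exact ⟨c₀, ⟨Limits.IsTerminal.ofUniqueHom (fun c => ⟨φ c, hφ c⟩)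
    fun c m => StrongMonad.CentralCone.Hom.ext (hφ_unique c m.φ m.w)⟩⟩
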